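/- Let $(R,\mathfrak m)$ be a commutative Noetherian local ring and let $M$ be a finitely generated $R$-module with projective dimension $\operatorname{pd}_R(M)=1$ that is locally free on the punctured spectrum, i.e. $M_{\mathfrak p}$ is a free $R_{\mathfrak p}$-module for every prime ideal $\mathfrak p\neq\mathfrak m$. Write $M^{\otimes i}$ for the $i$-fold tensor power of $M$ over $R$ (with $M^{\otimes 0}=R$). Then $\operatorname{depth}(R)$ is finite, and: (i) $\operatorname{depth}(M^{\otimes i})=\operatorname{depth}(R)-i$ for all integers $i$ with $0<i\le\operatorname{depth}(R)$; (ii) $\operatorname{depth}(M^{\otimes i})=0$ for all integers $i\ge\operatorname{depth}(R)$. Consequently $\operatorname{depth}(M^{\otimes i})=\max\{0,\operatorname{depth}(R)-i\}$ for all integers $i\ge 0$. -/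

import Mathlib

universe u v

open scoped TensorProduct

/-- The depth of a module `M` over a local ring `(R, 𝔪)`: the supremum of the lengths of the
`M`-regular sequences contained in `𝔪`, with the usual convention that it is `∞` if `𝔪 M = M`
(for finitely generated `M` this happens only if `M = 0`). -/
noncomputable def moduleDepth (R : Type*) [CommRing R] [IsLocalRing R]
    (M : Type*) [AddCommGroup M] [Module R M] : ℕ∞ :=
  open Classical in
  if IsLocalRing.maximalIdeal R • (⊤ : Submodule R M) = ⊤ then ⊤
  else ⨆ (rs : List R) (_ : ∀ r ∈ rs, r ∈ IsLocalRing.maximalIdeal R)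
    (_ : RingTheory.Sequence.IsRegular M rs), (rs.length : ℕ∞)

/-- `M` is locally free on the punctured spectrum of the local ring `(R, 𝔪)`: the localization
`M_𝔭` is a free `R_𝔭`-module for every prime ideal `𝔭 ≠ 𝔪`. -/
def IsLocallyFreeOnPuncturedSpectrum (R : Type*) [CommRing R] [IsLocalRing R]
    (M : Type*) [AddCommGroup M] [Module R M] : Prop :=
  ∀ p : PrimeSpectrum R, p.asIdeal ≠ IsLocalRing.maximalIdeal R →
    Module.Free (Localization.AtPrime p.asIdeal) (LocalizedModule p.asIdeal.primeCompl M)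

/-! Tensoring with `M` lowers the depth of every nonzero finite module `N` by exactly one, stopping
at zero (`moduleDepth_tensorProduct`); the theorem is the iteration of this from `N = R`. Take a
minimal presentation `0 → K → F → M → 0` with `K ≠ 0` and `F` free, which exists because `pd M = 1`.
If `N` has positive depth, then `K ⊗ N → F ⊗ N` stays injective: its kernel is supported only at
`𝔪`, while `K ⊗ N` has no socle (`rTensor_injective`). Diagram chases then show that an `N`-regular
`x ∈ 𝔪` is regular on `M ⊗ N` exactly when `N ⧸ xN` has trivial socle, so dividing by a common
regular element gives an induction. Depth zero of `N` passes to `M ⊗ N` through the `𝔪`-torsion of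
`N` (`trivialSocle_of_tensorProduct`). -/

open IsLocalRing Module RingTheory.Sequence Pointwise

/-! ### Socles, regular sequences and depth. -/

section Socle

variable (R : Type*) [CommRing R] [IsLocalRing R] (N : Type*) [AddCommGroup N] [Module R N]

/-- The module `N` over the local ring `(R, 𝔪)` has no nonzero element killed by `𝔪`. -/
def TrivialSocle : Prop := ∀ n : N, (∀ r ∈ maximalIdeal R, r • n = 0) → n = 0

/-- There is a weakly `N`-regular sequence of length `k` in the maximal ideal. -/
def HasRegularSequence (k : ℕ) : Prop :=
  ∃ rs : List R, rs.length = k ∧ (∀ r ∈ rs, r ∈ maximalIdeal R) ∧ IsWeaklyRegular N rs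

variable {R N} {N' : Type*} [AddCommGroup N'] [Module R N']

lemma TrivialSocle.of_injective (h : TrivialSocle R N') (f : N →ₗ[R] N')
    (hf : Function.Injective f) : TrivialSocle R N := fun n hn ↦
  hf <| by rw [map_zero]; exact h _ fun r hr ↦ by rw [← map_smul, hn r hr, map_zero]

/-- Products serve to find one element that is regular on several modules at once. -/
lemma TrivialSocle.prod (h : TrivialSocle R N) (h' : TrivialSocle R N') :
    TrivialSocle R (N × N') := fun _ hn ↦
  Prod.ext (h _ fun r hr ↦ congr_arg Prod.fst (hn r hr))
    (h' _ fun r hr ↦ congr_arg Prod.snd (hn r hr))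

lemma TrivialSocle.finsupp (h : TrivialSocle R N) (α : Type*) : TrivialSocle R (α →₀ N) :=
  fun _ hn ↦ Finsupp.ext fun a ↦ h _ fun r hr ↦ DFunLike.congr_fun (hn r hr) a

lemma TrivialSocle.of_isSMulRegular {x : R} (hx : x ∈ maximalIdeal R) (h : IsSMulRegular N x) :
    TrivialSocle R N := fun n hn ↦ h (by simpa using hn x hx)

/-- A map `R ⧸ 𝔪 → N` sends `1` into the socle, so `Hom(R ⧸ 𝔪, N) = 0`; over a Noetherian ring this
yields a regular element in the annihilator of `R ⧸ 𝔪`. -/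
lemma TrivialSocle.exists_isSMulRegular [IsNoetherianRing R] [Module.Finite R N]
    (h : TrivialSocle R N) : ∃ x ∈ maximalIdeal R, IsSMulRegular N x := by
  have : Subsingleton ((R ⧸ maximalIdeal R) →ₗ[R] N) := by
    refine subsingleton_of_forall_eq 0 fun f ↦ Submodule.linearMap_qext _ (LinearMap.ext_ring ?_)
    refine h _ fun r hr ↦ ?_
    have : f (r • Submodule.Quotient.mk 1) = 0 := by
      rw [← Submodule.Quotient.mk_smul, (Submodule.Quotient.mk_eq_zero _).2, map_zero]
      simpa using hr
    simpa using this
  obtain ⟨x, hx, hreg⟩ := IsSMulRegular.subsingleton_linearMap_iff.1 this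
  exact ⟨x, by rwa [Ideal.annihilator_quotient] at hx, hreg⟩

lemma trivialSocle_quotSMulTop_iff {x : R} : TrivialSocle R (QuotSMulTop x N) ↔
    ∀ n : N, (∀ r ∈ maximalIdeal R, ∃ n', r • n = x • n') → ∃ n', n = x • n' := by
  have key (n : N) : (Submodule.Quotient.mk n : QuotSMulTop x N) = 0 ↔ ∃ n', n = x • n' := by
    rw [Submodule.Quotient.mk_eq_zero, Submodule.mem_smul_pointwise_iff_exists]
    simp [eq_comm]
  refine ⟨fun h n hn ↦ (key n).1 (h _ fun r hr ↦ ?_), fun h n ↦ ?_⟩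
  · rw [← Submodule.Quotient.mk_smul, key]; exact hn r hr
  · obtain ⟨n, rfl⟩ := Submodule.Quotient.mk_surjective _ n
    simp_rw [← Submodule.Quotient.mk_smul, key]
    exact h n

/-- Whether `N ⧸ xN` has trivial socle does not depend on the `N`-regular element `x`. -/
lemma TrivialSocle.quotSMulTop_of_quotSMulTop {x y : R} (hy𝔪 : y ∈ maximalIdeal R)
    (hx : IsSMulRegular N x) (hy : IsSMulRegular N y)
    (h : TrivialSocle R (QuotSMulTop y N)) : TrivialSocle R (QuotSMulTop x N) := by
  rw [trivialSocle_quotSMulTop_iff] at h ⊢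
  intro n hn
  -- The relation `y • n = x • n'` matches socle classes `n` of `N ⧸ xN` with socle classes `n'` of
  -- `N ⧸ yN`; both socles compute `Ext¹(R ⧸ 𝔪, N)`.
  obtain ⟨n', hn'⟩ := hn y hy𝔪
  obtain ⟨w, rfl⟩ := h n' fun r hr ↦ by
    obtain ⟨n'', hn''⟩ := hn r hr
    refine ⟨n'', hx ?_⟩
    simp only
    rw [smul_comm x r, ← hn', smul_comm r y, hn'', smul_comm]
  exact ⟨w, hy (by simp only; rw [hn', smul_comm])⟩

lemma hasRegularSequence_zero : HasRegularSequence R N 0 := ⟨[], rfl, by simp, .nil _ _⟩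

lemma hasRegularSequence_succ {k : ℕ} : HasRegularSequence R N (k + 1) ↔
    ∃ x ∈ maximalIdeal R, IsSMulRegular N x ∧ HasRegularSequence R (QuotSMulTop x N) k := by
  constructor
  · rintro ⟨_ | ⟨x, rs⟩, hk, h𝔪, h⟩
    · simp at hk
    · rw [isWeaklyRegular_cons_iff] at h
      exact ⟨x, h𝔪 x (by simp), h.1, rs, by simpa using hk, fun r hr ↦ h𝔪 r (by simp [hr]), h.2⟩
  · rintro ⟨x, hx, hreg, rs, rfl, h𝔪, h⟩
    exact ⟨x :: rs, rfl, by simpa using ⟨hx, h𝔪⟩, .cons hreg h⟩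

lemma HasRegularSequence.of_le {k l : ℕ} (h : HasRegularSequence R N l) (hkl : k ≤ l) :
    HasRegularSequence R N k := by
  obtain ⟨rs, rfl, h𝔪, h⟩ := h
  rw [← List.take_append_drop k rs, isWeaklyRegular_append_iff] at h
  exact ⟨rs.take k, by simpa using hkl, fun r hr ↦ h𝔪 r (List.mem_of_mem_take hr), h.1⟩

lemma HasRegularSequence.congr {k : ℕ} (e : N ≃ₗ[R] N') :
    HasRegularSequence R N k ↔ HasRegularSequence R N' k := by
  simp_rw [HasRegularSequence, e.isWeaklyRegular_congr]

lemma HasRegularSequence.trivialSocle {k : ℕ} (h : HasRegularSequence R N (k + 1)) :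
    TrivialSocle R N := by
  obtain ⟨x, hx, hreg, -⟩ := hasRegularSequence_succ.1 h
  exact .of_isSMulRegular hx hreg

lemma hasRegularSequence_one [IsNoetherianRing R] [Module.Finite R N] :
    HasRegularSequence R N 1 ↔ TrivialSocle R N := by
  refine ⟨HasRegularSequence.trivialSocle, fun h ↦ ?_⟩
  obtain ⟨x, hx, hreg⟩ := h.exists_isSMulRegular
  exact hasRegularSequence_succ.2 ⟨x, hx, hreg, hasRegularSequence_zero⟩

omit [IsLocalRing R] in
lemma IsSMulRegular.quotSMulTop_comm {x y : R} (hx : IsSMulRegular N x)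
    (hy : IsSMulRegular (QuotSMulTop x N) y) :
    IsSMulRegular (QuotSMulTop y N) x := by
  rw [isSMulRegular_quotient_iff_mem_of_smul_mem] at hy ⊢
  intro n hn
  obtain ⟨w, -, hw⟩ := (Submodule.mem_smul_pointwise_iff_exists _ _ _).1 hn
  obtain ⟨w', -, rfl⟩ := (Submodule.mem_smul_pointwise_iff_exists _ _ _).1
    (hy w (hw ▸ Submodule.smul_mem_pointwise_smul n x ⊤ trivial))
  rw [smul_comm] at hw
  exact hx hw ▸ Submodule.smul_mem_pointwise_smul w' y ⊤ trivial

variable (N) in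
/-- The swap isomorphism `(N ⧸ xN) ⧸ y(N ⧸ xN) ≃ (N ⧸ yN) ⧸ x(N ⧸ yN)`. -/
noncomputable def quotSMulTopComm (x y : R) :
    QuotSMulTop y (QuotSMulTop x N) ≃ₗ[R] QuotSMulTop x (QuotSMulTop y N) :=
  QuotSMulTop.equivQuotTensor y _ ≪≫ₗ (QuotSMulTop.equivQuotTensor x N).lTensor _ ≪≫ₗ
    TensorProduct.leftComm R _ _ N ≪≫ₗ (QuotSMulTop.equivQuotTensor y N).symm.lTensor _ ≪≫ₗ
      (QuotSMulTop.equivQuotTensor x _).symm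

/-- Every `N`-regular element of the maximal ideal starts a regular sequence of any length that is
attained by some regular sequence. -/
lemma HasRegularSequence.quotSMulTop [IsNoetherianRing R] {k : ℕ} [Module.Finite R N] {x : R}
    (hx𝔪 : x ∈ maximalIdeal R) (hx : IsSMulRegular N x) (h : HasRegularSequence R N (k + 1)) :
    HasRegularSequence R (QuotSMulTop x N) k := by
  induction k generalizing N x with
  | zero => exact hasRegularSequence_zero
  | succ k ih =>
    obtain ⟨y, hy𝔪, hy, h⟩ := hasRegularSequence_succ.1 h
    have hsx := h.trivialSocle.quotSMulTop_of_quotSMulTop hy𝔪 hx hy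
    -- An auxiliary `z`, regular on `N`, `N ⧸ xN` and `N ⧸ yN`, links `y` to `x`: the induction
    -- hypothesis is applied to `N ⧸ yN` with `z`, then to `N ⧸ zN` with `x`.
    obtain ⟨z, hz𝔪, hz⟩ := ((TrivialSocle.of_isSMulRegular hx𝔪 hx).prod
      (hsx.prod h.trivialSocle)).exists_isSMulRegular
    obtain ⟨hzN, hzx, hzy⟩ : IsSMulRegular N z ∧ IsSMulRegular (QuotSMulTop x N) z ∧
        IsSMulRegular (QuotSMulTop y N) z := by simpa only [Prod.isSMulRegular_iff] using hz
    have h₁ : HasRegularSequence R (QuotSMulTop z N) (k + 1) := hasRegularSequence_succ.2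
      ⟨y, hy𝔪, hy.quotSMulTop_comm hzy,
        (HasRegularSequence.congr (quotSMulTopComm N y z)).1 (ih hz𝔪 hzy h)⟩
    exact hasRegularSequence_succ.2 ⟨z, hz𝔪, hzx,
      (HasRegularSequence.congr (quotSMulTopComm N z x)).1
        (ih hx𝔪 (hx.quotSMulTop_comm hzx) h₁)⟩

/-- By Nakayama weakly regular sequences in `𝔪` are regular, and longer sequences can be truncated.
-/
lemma natCast_le_moduleDepth_iff [Module.Finite R N] [Nontrivial N] {k : ℕ} :
    (k : ℕ∞) ≤ moduleDepth R N ↔ HasRegularSequence R N k := by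
  have hN : maximalIdeal R • (⊤ : Submodule R N) ≠ ⊤ :=
    (Submodule.top_ne_ideal_smul_of_le_jacobson_annihilator (maximalIdeal_le_jacobson _)).symm
  rw [moduleDepth, if_neg hN]
  constructor
  · intro h
    rcases k with _ | k
    · exact hasRegularSequence_zero
    have := lt_of_lt_of_le (b := ((k + 1 : ℕ) : ℕ∞)) (a := (k : ℕ∞)) (by norm_cast; omega) h
    simp only [lt_iSup_iff] at this
    obtain ⟨rs, h𝔪, hrs, hk⟩ := this
    exact HasRegularSequence.of_le ⟨rs, rfl, h𝔪, hrs.1⟩ (by norm_cast at hk)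
  · rintro ⟨rs, rfl, h𝔪, hrs⟩
    exact le_iSup₂_of_le rs h𝔪 <| le_iSup_of_le (.of_isWeaklyRegular_of_mem_maximalIdeal N h𝔪 hrs)
      le_rfl

lemma moduleDepth_congr [Module.Finite R N] [Nontrivial N] (e : N ≃ₗ[R] N') :
    moduleDepth R N = moduleDepth R N' := by
  have := Module.Finite.equiv e
  have := e.symm.toEquiv.nontrivial
  refine ENat.eq_of_forall_natCast_le_iff fun k ↦ ?_
  rw [natCast_le_moduleDepth_iff, natCast_le_moduleDepth_iff, HasRegularSequence.congr e]

/-- A regular sequence lowers the finite Krull dimension by its length, so none has length `dim R +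
1`. -/
lemma moduleDepth_self_ne_top [IsNoetherianRing R] : moduleDepth R R ≠ ⊤ := by
  intro h
  obtain ⟨d, hd⟩ : ∃ d : ℕ, ringKrullDim R = d := by
    have h₁ := ringKrullDim_nonneg_of_nontrivial (R := R)
    have h₂ := ringKrullDim_ne_top (R := R)
    generalize ringKrullDim R = e at h₁ h₂
    induction e with
    | bot => simp at h₁
    | coe e =>
      induction e with
      | top => exact absurd rfl h₂
      | coe d => exact ⟨d, rfl⟩
  obtain ⟨rs, hlen, h𝔪, hrs⟩ :=
    natCast_le_moduleDepth_iff.1 (h ▸ le_top : ((d + 1 : ℕ) : ℕ∞) ≤ moduleDepth R R)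
  have hreg := IsRegular.of_isWeaklyRegular_of_mem_maximalIdeal R h𝔪 hrs
  have heq := ringKrullDim_add_length_eq_ringKrullDim_of_isRegular rs hreg
  have : Nontrivial (R ⧸ Ideal.ofList rs) := Ideal.Quotient.nontrivial_iff.2 fun h' ↦
    hreg.top_ne_smul (by simp [h'])
  have hle : ringKrullDim R + 1 ≤ ringKrullDim R := by
    conv_rhs => rw [← heq, hlen]
    rw [hd, Nat.cast_add, Nat.cast_one]
    exact le_add_of_nonneg_left ringKrullDim_nonneg_of_nontrivial
  rw [hd] at hle
  norm_cast at hle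
  omega

end Socle

/-! ### Tensoring with a module that has a minimal presentation. -/

section MinimalPresentation

variable {R : Type*} [CommRing R] [IsLocalRing R]
  {K : Type*} [AddCommGroup K] [Module R K] {F : Type*} [AddCommGroup F] [Module R F]
  {M : Type*} [AddCommGroup M] [Module R M]

/-- A short exact sequence `0 → K → F → M → 0` such that `K` lands in `𝔪F` and such that `K → F`
splits locally at every prime ideal different from `𝔪`. -/
structure IsMinimalPresentation (ι : K →ₗ[R] F) (π : F →ₗ[R] M) : Prop where
  injective : Function.Injective ι
  exact : Function.Exact ι π
  surjective : Function.Surjective π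
  mem_smul_top : ∀ k, ι k ∈ maximalIdeal R • (⊤ : Submodule R F)
  exists_retraction : ∀ p : Ideal R, p.IsPrime → p ≠ maximalIdeal R →
    ∃ r ∉ p, ∃ ρ : F →ₗ[R] K, ρ ∘ₗ ι = r • LinearMap.id

variable {N : Type*} [AddCommGroup N] [Module R N] {ι : K →ₗ[R] F} {π : F →ₗ[R] M}

lemma TrivialSocle.tensorProduct (h : TrivialSocle R N) [Module.Free R K] :
    TrivialSocle R (K ⊗[R] N) :=
  (h.finsupp _).of_injective
    (TensorProduct.equivFinsuppOfBasisLeft (Free.chooseBasis R K)).toLinearMap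
    (LinearEquiv.injective _)

/-- Nakayama reduces this to nonzero vector spaces over the residue field. -/
lemma nontrivial_tensorProduct [Module.Finite R M] [Nontrivial M] [Module.Finite R N]
    [Nontrivial N] : Nontrivial (M ⊗[R] N) := by
  let k := ResidueField R
  have hM : Nontrivial (k ⊗[R] M) := not_subsingleton_iff_nontrivial.1 fun h ↦
    not_subsingleton M (subsingleton_tensorProduct.1 h)
  have hN : Nontrivial (k ⊗[R] N) := not_subsingleton_iff_nontrivial.1 fun h ↦
    not_subsingleton N (subsingleton_tensorProduct.1 h)
  have := (TensorProduct.AlgebraTensorModule.distribBaseChange R k M N).toEquiv.nontrivial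
  exact not_subsingleton_iff_nontrivial.1 fun h ↦
    not_subsingleton (k ⊗[R] (M ⊗[R] N)) inferInstance

variable (R N) in
/-- The submodule of elements annihilated by a power of each element of the maximal ideal. -/
def maximalIdealTorsion : Submodule R N where
  carrier := {n | ∀ r ∈ maximalIdeal R, ∃ k : ℕ, r ^ k • n = 0}
  zero_mem' _ _ := ⟨0, smul_zero _⟩
  add_mem' {n n'} hn hn' r hr := by
    obtain ⟨k, hk⟩ := hn r hr
    obtain ⟨l, hl⟩ := hn' r hr
    exact ⟨k + l, by rw [smul_add, pow_add, mul_smul _ _ n', hl, mul_comm, mul_smul, hk]; simp⟩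
  smul_mem' c n hn r hr := by
    obtain ⟨k, hk⟩ := hn r hr
    exact ⟨k, by rw [smul_comm, hk, smul_zero]⟩

lemma trivialSocle_quotient_maximalIdealTorsion :
    TrivialSocle R (N ⧸ maximalIdealTorsion R N) := by
  intro n hn
  obtain ⟨n, rfl⟩ := Submodule.Quotient.mk_surjective _ n
  rw [Submodule.Quotient.mk_eq_zero]
  intro r hr
  have := hn r hr
  rw [← Submodule.Quotient.mk_smul, Submodule.Quotient.mk_eq_zero] at this
  obtain ⟨k, hk⟩ := this r hr
  exact ⟨k + 1, by rwa [pow_succ, mul_smul]⟩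

namespace IsMinimalPresentation

variable (h : IsMinimalPresentation ι π)
include h

/-- A nonzero kernel would have an associated prime `p = ann w`. If `p ≠ 𝔪`, a retraction up to some
`r ∉ p` gives `r • w = 0`, which is absurd; if `p = 𝔪`, then `w` lies in the socle of `K ⊗ N`, a
direct sum of copies of `N`. -/
lemma rTensor_injective [IsNoetherianRing R] [Module.Free R K] (hN : TrivialSocle R N) :
    Function.Injective (ι.rTensor N) := by
  rw [← LinearMap.ker_eq_bot, ← Submodule.subsingleton_iff_eq_bot]
  by_contra! hnt
  obtain ⟨p, hp⟩ := associatedPrimes.nonempty R (LinearMap.ker (ι.rTensor N))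
  obtain ⟨hp, w, hw⟩ := isAssociatedPrime_iff.1 hp
  have hmem (r : R) : r ∈ p ↔ r • (w : K ⊗[R] N) = 0 := by
    rw [hw, Submodule.mem_colon_singleton, Submodule.mem_bot, ← Submodule.coe_smul,
      ZeroMemClass.coe_eq_zero]
  obtain rfl : p = maximalIdeal R := by
    by_contra hne
    obtain ⟨r, hr, ρ, hρ⟩ := h.exists_retraction p hp hne
    apply hr
    rw [hmem]
    have h₁ := congr_arg (ρ.rTensor N) (LinearMap.mem_ker.1 w.2)
    rw [← LinearMap.rTensor_comp_apply, hρ, map_zero] at h₁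
    simpa using h₁
  have h0 := hN.tensorProduct (K := K) w fun r hr ↦ (hmem r).1 hr
  exact hp.ne_top ((Ideal.eq_top_iff_one _).2 ((hmem 1).2 (by rw [h0, smul_zero])))

lemma rTensor_exact : Function.Exact (ι.rTensor N) (π.rTensor N) :=
  _root_.rTensor_exact N h.exact h.surjective

lemma rTensor_surjective : Function.Surjective (π.rTensor N) :=
  LinearMap.rTensor_surjective N h.surjective

/-- An element `x` that is regular on `N` is regular on `M ⊗ N` if `N ⧸ xN` has trivial socle. -/
lemma isSMulRegular_tensorProduct [IsNoetherianRing R] [Module.Free R K] [Module.Free R F] {x : R}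
    (hx : IsSMulRegular N x) (hN : TrivialSocle R (QuotSMulTop x N)) :
    IsSMulRegular (M ⊗[R] N) x := by
  rw [isSMulRegular_iff_right_eq_zero_of_smul]
  intro c hc
  obtain ⟨f, rfl⟩ := h.rTensor_surjective c
  rw [← map_smul] at hc
  obtain ⟨g, hg⟩ := (h.rTensor_exact _).1 hc
  let q : N →ₗ[R] QuotSMulTop x N := Submodule.mkQ _
  have hq : x • q = 0 := LinearMap.ext fun n ↦ (Submodule.Quotient.mk_eq_zero _).2
    (Submodule.smul_mem_pointwise_smul n x ⊤ trivial)
  -- Since `g` maps to `x • f`, it dies in `F ⊗ (N ⧸ xN)`, hence already in `K ⊗ (N ⧸ xN)`. So `g`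
  -- is divisible by `x`, and cancelling `x` in `F ⊗ N` puts `f` in the image of `K ⊗ N`.
  have hqg : q.lTensor K g = 0 := by
    refine h.rTensor_injective hN ?_
    rw [map_zero, ← LinearMap.comp_apply, LinearMap.rTensor_comp_lTensor,
      ← LinearMap.lTensor_comp_rTensor, LinearMap.comp_apply, hg, map_smul,
      ← LinearMap.smul_apply, ← LinearMap.lTensor_smul, hq, LinearMap.lTensor_zero,
      LinearMap.zero_apply]
  obtain ⟨g', rfl⟩ := (lTensor_exact K (LinearMap.exact_lsmul_mkQ_smul_top N x)
    (Submodule.mkQ_surjective _) _).1 hqg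
  have hf : f = ι.rTensor N g' := by
    refine hx.lTensor F ?_
    have : (LinearMap.lsmul R N x).lTensor K = LinearMap.lsmul R (K ⊗[R] N) x :=
      TensorProduct.ext' fun k n ↦ by simp
    simp only
    rw [← hg, this, LinearMap.lsmul_apply, map_smul]
  rw [hf]
  exact (h.rTensor_exact _).2 ⟨g', rfl⟩

/-- Minimality enters here. If `n` is a socle element modulo `x` and `b i` is a basis vector of `K ⊆
𝔪F`, then `b i ⊗ n = x • t` in `F ⊗ N`. Regularity of `x` on `M ⊗ N` pulls `t` back to `K ⊗ N`, and
the `i`-th coordinate shows that `x` divides `n`. -/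
lemma trivialSocle_quotSMulTop [IsNoetherianRing R] [Module.Free R K] [Nontrivial K] {x : R}
    (hx𝔪 : x ∈ maximalIdeal R) (hx : IsSMulRegular N x) (hx' : IsSMulRegular (M ⊗[R] N) x) :
    TrivialSocle R (QuotSMulTop x N) := by
  rw [trivialSocle_quotSMulTop_iff]
  intro n hn
  have key (f : F) (hf : f ∈ maximalIdeal R • (⊤ : Submodule R F)) :
      ∃ t : F ⊗[R] N, f ⊗ₜ n = x • t := by
    induction hf using Submodule.smul_induction_on' with
    | smul r hr f _ =>
      obtain ⟨n', hn'⟩ := hn r hr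
      exact ⟨f ⊗ₜ n', by rw [TensorProduct.smul_tmul, hn', TensorProduct.tmul_smul]⟩
    | add f _ f' _ ih ih' =>
      obtain ⟨t, ht⟩ := ih
      obtain ⟨t', ht'⟩ := ih'
      exact ⟨t + t', by rw [TensorProduct.add_tmul, ht, ht', smul_add]⟩
  let b := Free.chooseBasis R K
  obtain ⟨i⟩ := b.index_nonempty
  obtain ⟨t, ht⟩ := key _ (h.mem_smul_top (b i))
  have hπt : π.rTensor N t = 0 := by
    refine isSMulRegular_iff_right_eq_zero_of_smul.1 hx' _ ?_
    rw [← map_smul, ← ht]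
    exact (h.rTensor_exact _).2 ⟨b i ⊗ₜ n, by simp⟩
  obtain ⟨g, rfl⟩ := (h.rTensor_exact _).1 hπt
  have hg : b i ⊗ₜ n = x • g :=
    h.rTensor_injective (.of_isSMulRegular hx𝔪 hx) (by rw [map_smul, ← ht]; simp)
  exact ⟨TensorProduct.lid R N ((b.coord i).rTensor N g), by
    rw [← map_smul, ← map_smul, ← hg]; simp⟩

variable (N) in
/-- Tensoring with `M` preserves injectivity of a submodule inclusion whose cokernel has trivial
socle. -/
lemma lTensor_subtype_injective [IsNoetherianRing R] [Module.Free R K] [Module.Free R F]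
    (Γ : Submodule R N) (hΓ : TrivialSocle R (N ⧸ Γ)) :
    Function.Injective (Γ.subtype.lTensor M) := by
  rw [injective_iff_map_eq_zero]
  intro u hu
  obtain ⟨v, rfl⟩ := h.rTensor_surjective u
  have hv : π.rTensor N (Γ.subtype.lTensor F v) = 0 := by
    rw [← hu, ← LinearMap.comp_apply, ← LinearMap.comp_apply, LinearMap.rTensor_comp_lTensor,
      LinearMap.lTensor_comp_rTensor]
  obtain ⟨g, hg⟩ := (h.rTensor_exact _).1 hv
  -- Injectivity of `K ⊗ (N ⧸ Γ) → F ⊗ (N ⧸ Γ)`, that is `Tor₁(M, N ⧸ Γ) = 0`, forces `g` to come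
  -- from `K ⊗ Γ`.
  have hqg : Γ.mkQ.lTensor K g = 0 := by
    refine h.rTensor_injective hΓ ?_
    rw [map_zero, ← LinearMap.comp_apply, LinearMap.rTensor_comp_lTensor,
      ← LinearMap.lTensor_comp_rTensor, LinearMap.comp_apply, hg, ← LinearMap.lTensor_comp_apply]
    have : Γ.mkQ ∘ₗ Γ.subtype = 0 := by ext; simp
    simp [this]
  obtain ⟨g', rfl⟩ := (lTensor_exact K (LinearMap.exact_subtype_mkQ Γ)
    (Submodule.mkQ_surjective _) _).1 hqg
  refine (h.rTensor_exact _).2 ⟨g', ?_⟩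
  apply Module.Flat.lTensor_preserves_injective_linearMap (M := F) Γ.subtype Γ.injective_subtype
  rw [← hg, ← LinearMap.comp_apply, ← LinearMap.comp_apply, LinearMap.lTensor_comp_rTensor,
    LinearMap.rTensor_comp_lTensor]

/-- Let `Γ` be the `𝔪`-torsion of `N`. Since `M ⊗ Γ` embeds in `M ⊗ N`, some `x ∈ 𝔪` is regular on
it; but each element of `M ⊗ Γ` is killed by a power of `x`. Hence `M ⊗ Γ = 0`, so `Γ = 0`, and `Γ`
contains the socle of `N`. -/
lemma trivialSocle_of_tensorProduct [IsNoetherianRing R] [Module.Free R K] [Module.Free R F]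
    [Module.Finite R M] [Nontrivial M] [Module.Finite R N] (hMN : TrivialSocle R (M ⊗[R] N)) :
    TrivialSocle R N := by
  let Γ := maximalIdealTorsion R N
  have hinj := h.lTensor_subtype_injective N Γ trivialSocle_quotient_maximalIdealTorsion
  obtain ⟨x, hx, hreg⟩ := (hMN.of_injective _ hinj).exists_isSMulRegular
  have hnil (z : M ⊗[R] Γ) : ∃ k : ℕ, x ^ k • z = 0 := by
    induction z with
    | zero => exact ⟨0, smul_zero _⟩
    | tmul m n =>
      obtain ⟨k, hk⟩ := n.2 x hx
      refine ⟨k, ?_⟩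
      rw [← TensorProduct.tmul_smul, show x ^ k • n = 0 from Subtype.ext hk, TensorProduct.tmul_zero]
    | add z z' hz hz' =>
      obtain ⟨k, hk⟩ := hz
      obtain ⟨l, hl⟩ := hz'
      exact ⟨k + l, by rw [smul_add, pow_add, mul_smul _ _ z', hl, mul_comm, mul_smul, hk]; simp⟩
  have : Subsingleton (M ⊗[R] Γ) := subsingleton_of_forall_eq 0 fun z ↦ by
    obtain ⟨k, hk⟩ := hnil z
    exact (hreg.pow k) (by simpa using hk)
  have : Subsingleton Γ := not_nontrivial_iff_subsingleton.1 fun _ ↦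
    not_nontrivial_iff_subsingleton.2 this nontrivial_tensorProduct
  intro n hn
  exact congr_arg Subtype.val
    (Subsingleton.elim (⟨n, fun r hr ↦ ⟨1, by rw [pow_one, hn r hr]⟩⟩ : Γ) 0)

lemma hasRegularSequence_tensorProduct_iff [IsNoetherianRing R] [Module.Free R K] [Nontrivial K]
    [Module.Free R F] [Module.Finite R M] [Nontrivial M] [Module.Finite R N] {k : ℕ} :
    HasRegularSequence R (M ⊗[R] N) (k + 1) ↔ HasRegularSequence R N (k + 2) := by
  induction k using Nat.strong_induction_on generalizing N with | _ k ih => ?_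
  -- The induction passes through `(M ⊗ N) ⧸ x ≃ M ⊗ (N ⧸ xN)`. For `k = 0` the left side is vacuous
  -- and the right side is `hs`.
  have step (x : R) (hs : TrivialSocle R (QuotSMulTop x N)) :
      HasRegularSequence R (QuotSMulTop x (M ⊗[R] N)) k ↔
        HasRegularSequence R (QuotSMulTop x N) (k + 1) := by
    rw [← HasRegularSequence.congr (QuotSMulTop.tensorQuotSMulTopEquivQuotSMulTop x M N)]
    rcases k with _ | k
    · simp only [hasRegularSequence_zero, zero_add, hasRegularSequence_one, hs]
    · exact ih k (Nat.lt_add_one k)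
  constructor
  · intro hMN
    obtain ⟨z, hz𝔪, hz⟩ :=
      ((h.trivialSocle_of_tensorProduct hMN.trivialSocle).prod
        hMN.trivialSocle).exists_isSMulRegular
    obtain ⟨hz, hz'⟩ := Prod.isSMulRegular_iff.1 hz
    have hs := h.trivialSocle_quotSMulTop hz𝔪 hz hz'
    exact hasRegularSequence_succ.2 ⟨z, hz𝔪, hz, (step z hs).1 (hMN.quotSMulTop hz𝔪 hz')⟩
  · intro hN
    obtain ⟨x, hx𝔪, hx, hN⟩ := hasRegularSequence_succ.1 hN
    exact hasRegularSequence_succ.2 ⟨x, hx𝔪, h.isSMulRegular_tensorProduct hx hN.trivialSocle,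
      (step x hN.trivialSocle).2 hN⟩

lemma moduleDepth_tensorProduct [IsNoetherianRing R] [Module.Free R K] [Nontrivial K]
    [Module.Free R F] [Module.Finite R M] [Nontrivial M] [Module.Finite R N] [Nontrivial N] :
    moduleDepth R (M ⊗[R] N) = moduleDepth R N - 1 := by
  have := nontrivial_tensorProduct (R := R) (M := M) (N := N)
  refine ENat.eq_of_forall_natCast_le_iff fun k ↦ ?_
  -- The case `k = 0` carries no information, so truncated subtraction also covers `N` of depth
  -- zero.
  rcases k with _ | k
  · simp
  have hsub : ((k + 1 : ℕ) : ℕ∞) ≤ moduleDepth R N - 1 ↔ ((k + 2 : ℕ) : ℕ∞) ≤ moduleDepth R N := by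
    generalize moduleDepth R N = d
    induction d with
    | top => simp
    | coe d =>
      norm_cast
      omega
  rw [hsub, natCast_le_moduleDepth_iff, natCast_le_moduleDepth_iff,
    h.hasRegularSequence_tensorProduct_iff]

lemma moduleDepth_tensorPower [IsNoetherianRing R] [Module.Free R K] [Nontrivial K]
    [Module.Free R F] [Module.Finite R M] [Nontrivial M] (i : ℕ) :
    moduleDepth R (⨂[R]^i M) = moduleDepth R R - (i : ℕ∞) ∧
      Module.Finite R (⨂[R]^i M) ∧ Nontrivial (⨂[R]^i M) := by
  induction i with
  | zero =>
    let e : R ≃ₗ[R] ⨂[R]^0 M := TensorPower.algebraMap₀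
    exact ⟨by rw [← moduleDepth_congr e, Nat.cast_zero, tsub_zero], .equiv e,
      e.symm.toEquiv.nontrivial⟩
  | succ i ih =>
    obtain ⟨ih, _, _⟩ := ih
    have := nontrivial_tensorProduct (R := R) (M := M) (N := ⨂[R]^i M)
    let e : M ⊗[R] (⨂[R]^i M) ≃ₗ[R] ⨂[R]^(i + 1) M :=
      (PiTensorProduct.subsingletonEquiv (R := R) (s := fun _ ↦ M)
        (0 : Fin 1)).symm.rTensor (⨂[R]^i M) ≪≫ₗ
        TensorPower.mulEquiv ≪≫ₗ TensorPower.cast R M (add_comm 1 i)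
    exact ⟨by rw [← moduleDepth_congr e, h.moduleDepth_tensorProduct, ih, tsub_tsub,
      Nat.cast_add, Nat.cast_one], .equiv e, e.symm.toEquiv.nontrivial⟩

end IsMinimalPresentation

end MinimalPresentation

/-! ### Existence of minimal presentations and their local splitting. -/

section Existence

variable {R : Type u} [CommRing R] {M : Type v} [AddCommGroup M] [Module R M]

/-- If `M` has projective dimension at most one, the kernel of a surjection from a projective
module onto `M` is projective. -/
lemma projective_ker_of_hasProjectiveDimensionLT_two [Small.{v} R] {F : Type v} [AddCommGroup F]
    [Module R F] [Module.Projective R F] (π : F →ₗ[R] M) (hπ : Function.Surjective π)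
    [CategoryTheory.HasProjectiveDimensionLT (ModuleCat.of R M) 2] :
    Module.Projective R (LinearMap.ker π) := by
  have hS := LinearMap.shortExact_shortComplexKer hπ
  have h := (hS.hasProjectiveDimensionLT_X₃_iff 0
    (inferInstanceAs (CategoryTheory.Projective (ModuleCat.of R F)))).1 ‹_›
  rw [zero_add, ← CategoryTheory.projective_iff_hasProjectiveDimensionLT_one] at h
  exact (IsProjective.iff_projective (LinearMap.ker π)).2 h

variable [IsLocalRing R]

variable (R M) in
/-- A finite module over a local ring has a minimal free cover. -/
lemma exists_minimal_cover [Module.Finite R M] :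
    ∃ (n : ℕ) (π : (Fin n → R) →ₗ[R] M), Function.Surjective π ∧
      ∀ f, π f = 0 → f ∈ maximalIdeal R • (⊤ : Submodule R (Fin n → R)) := by
  -- Lifts of a basis of `M ⧸ 𝔪M` generate `M` by Nakayama; linear independence over the residue
  -- field puts the coefficients of every relation in `𝔪`.
  let b := finBasis (ResidueField R) (ResidueField R ⊗[R] M)
  have hmk := TensorProduct.mk_surjective R M (ResidueField R) Ideal.Quotient.mk_surjective
  choose v hv using fun i ↦ hmk (b i)
  refine ⟨_, Fintype.linearCombination R v, ?_, fun f hf ↦ ?_⟩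
  · rw [← LinearMap.range_eq_top, Fintype.range_linearCombination]
    exact span_eq_top_of_tmul_eq_basis v b hv
  · have hf' : ∑ i, residue R (f i) • b i = 0 := by
      rw [← map_zero (TensorProduct.mk R (ResidueField R) M 1), ← hf,
        Fintype.linearCombination_apply, map_sum]
      refine Finset.sum_congr rfl fun i _ ↦ ?_
      rw [map_smul, hv]
      exact algebraMap_smul (ResidueField R) (f i) (b i)
    have h0 := Fintype.linearIndependent_iff.1 b.linearIndependent _ hf'
    rw [pi_eq_sum_univ' f]
    exact Submodule.sum_mem _ fun i _ ↦
      Submodule.smul_mem_smul ((residue_eq_zero_iff _).1 (h0 i)) trivial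

omit [IsLocalRing R] in
/-- The splitting of a surjection `F → M` at a prime where `M` is locally free, with denominators
cleared. -/
lemma exists_retraction_of_free_localizedModule {F : Type*} [AddCommGroup F] [Module R F]
    [Module.FinitePresentation R M] (π : F →ₗ[R] M) (hπ : Function.Surjective π)
    (p : Ideal R) [p.IsPrime]
    [Module.Free (Localization.AtPrime p) (LocalizedModule p.primeCompl M)] :
    ∃ r ∉ p, ∃ ρ : F →ₗ[R] LinearMap.ker π,
      ρ ∘ₗ (LinearMap.ker π).subtype = r • LinearMap.id := by
  let S := p.primeCompl
  let πp := LocalizedModule.map S π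
  obtain ⟨σ, hσ⟩ := Module.projective_lifting_property πp LinearMap.id
    (LocalizedModule.map_surjective S π hπ)
  -- Finite presentation lifts the local section `σ`, times a denominator `t`, to `s : M → F`. The
  -- identity `π ∘ s = t` holds only after localization; a second factor `t'` makes it hold over
  -- `R`.
  obtain ⟨s, t, hs⟩ := Module.FinitePresentation.exists_lift_of_isLocalizedModule S
    (LocalizedModule.mkLinearMap S F) (σ.restrictScalars R ∘ₗ LocalizedModule.mkLinearMap S M)
  have hcomp : LocalizedModule.mkLinearMap S M ∘ₗ (π ∘ₗ s) =
      LocalizedModule.mkLinearMap S M ∘ₗ ((t : R) • LinearMap.id) := by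
    ext m
    have h₁ : πp (LocalizedModule.mkLinearMap S F (s m)) =
        πp ((t : R) • σ (LocalizedModule.mkLinearMap S M m)) :=
      congr_arg πp (LinearMap.congr_fun hs m)
    have h₂ : πp (σ (LocalizedModule.mkLinearMap S M m)) = LocalizedModule.mkLinearMap S M m :=
      LinearMap.congr_fun hσ _
    have h₃ : πp (LocalizedModule.mkLinearMap S F (s m)) =
        LocalizedModule.mkLinearMap S M (π (s m)) := by
      simp [πp, LocalizedModule.map_mk]
    rw [LinearMap.map_smul_of_tower, h₂, h₃] at h₁
    simpa using h₁
  obtain ⟨t', ht'⟩ := Module.Finite.exists_smul_of_comp_eq_of_isLocalizedModule S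
    (LocalizedModule.mkLinearMap S M) _ _ hcomp
  have key (f : F) : π ((t' * t : R) • f - (t' : R) • s (π f)) = 0 := by
    have := LinearMap.congr_fun ht' (π f)
    rw [map_sub, map_smul, map_smul, sub_eq_zero, mul_smul]
    exact this.symm
  refine ⟨t' * t, p.primeCompl.mul_mem t'.2 t.2,
    ((t' * t : R) • LinearMap.id - (t' : R) • s ∘ₗ π).codRestrict _ key, ?_⟩
  ext k
  change (t' * t : R) • (k : F) - (t' : R) • s (π k) = (t' * t : R) • (k : F)
  rw [LinearMap.mem_ker.1 k.2, map_zero, smul_zero, sub_zero]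

end Existence

theorem mainTheorem2 (R : Type u) [CommRing R] [IsLocalRing R] [IsNoetherianRing R]
    [Small.{v} R] (M : Type v) [AddCommGroup M] [Module R M] [Module.Finite R M]
    (hfree : IsLocallyFreeOnPuncturedSpectrum R M)
    (hpd : CategoryTheory.projectiveDimension (ModuleCat.of R M) = 1) :
    moduleDepth R R ≠ ⊤ ∧
    (∀ i : ℕ, 0 < i → (i : ℕ∞) ≤ moduleDepth R R →
      moduleDepth R (⨂[R]^i M) = moduleDepth R R - (i : ℕ∞)) ∧
    (∀ i : ℕ, moduleDepth R R ≤ (i : ℕ∞) → moduleDepth R (⨂[R]^i M) = 0) ∧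
    (∀ i : ℕ, moduleDepth R (⨂[R]^i M) = max 0 (moduleDepth R R - (i : ℕ∞))) := by
  have hM : ¬ Module.Projective R M := by
    intro hM
    have : CategoryTheory.HasProjectiveDimensionLT (ModuleCat.of R M) 1 := by
      rw [← CategoryTheory.projective_iff_hasProjectiveDimensionLT_one]
      exact (IsProjective.iff_projective M).1 hM
    have := CategoryTheory.projectiveDimension_lt_iff.2 this
    simp [hpd] at this
  have : CategoryTheory.HasProjectiveDimensionLT (ModuleCat.of R M) 2 := by
    rw [← CategoryTheory.projectiveDimension_lt_iff, hpd]
    exact_mod_cast one_lt_two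
  have hM0 : Nontrivial M := by
    by_contra h
    rw [not_nontrivial_iff_subsingleton] at h
    exact hM inferInstance
  obtain ⟨n, π, hπ, hmin⟩ := exists_minimal_cover R M
  -- The criterion for a projective kernel needs the free module in the universe of `M`.
  let e : (Fin n → Shrink.{v} R) ≃ₗ[R] (Fin n → R) :=
    LinearEquiv.piCongrRight fun _ ↦ Shrink.linearEquiv R R
  have : Module.Projective R (Fin n → Shrink.{v} R) := .of_equiv e.symm
  have := projective_ker_of_hasProjectiveDimensionLT_two (π ∘ₗ e.toLinearMap)
    (hπ.comp e.surjective)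
  have : Module.Projective R (LinearMap.ker π) := by
    rw [LinearMap.ker_comp, Submodule.comap_equiv_eq_map_symm] at this
    exact .of_equiv (e.symm.submoduleMap (LinearMap.ker π)).symm
  have : Module.Free R (LinearMap.ker π) := free_of_flat_of_isLocalRing
  -- If the kernel vanished, `M` would be free, contradicting `pd M = 1`.
  have : Nontrivial (LinearMap.ker π) := by
    by_contra h
    rw [not_nontrivial_iff_subsingleton, Submodule.subsingleton_iff_eq_bot,
      LinearMap.ker_eq_bot] at h
    exact hM (.of_equiv (.ofBijective π ⟨h, hπ⟩))
  have hpres : IsMinimalPresentation (LinearMap.ker π).subtype π :=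
    { injective := Submodule.subtype_injective _
      exact := LinearMap.exact_subtype_ker_map π
      surjective := hπ
      mem_smul_top := fun k ↦ hmin k k.2
      exists_retraction := fun p hp hne ↦ by
        have := Module.finitePresentation_of_finite R M
        have := hfree ⟨p, hp⟩ hne
        exact exists_retraction_of_free_localizedModule π hπ p }
  have hdepth (i : ℕ) := (hpres.moduleDepth_tensorPower i).1
  exact ⟨moduleDepth_self_ne_top, fun i _ _ ↦ hdepth i,
    fun i hi ↦ by rw [hdepth, tsub_eq_zero_of_le hi], fun i ↦ by rw [hdepth, max_eq_right zero_le]⟩
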